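/- Let $G=(U,V)$ be a finite simple plane bipartite graph with colour classes $U,V$ and $|U|=|V|$, in which every edge $f$ carries a weight $\omega_f$ (in a commutative ring, for instance a real number or an indeterminate). For a graph $H$ obtained from $G$ by deleting vertices (with their incident edges) and edges, let $M(H)$ denote the sum, over all perfect matchings of $H$, of the product of the weights of the edges in the matching (an empty product being $1$). Let $a_1$ and $b_1$ be two vertices of $G$ of different colours and let $e=a_2b_2$ be an edge of $G$, and suppose that $a_1,b_1,a_2,b_2$ are four distinct vertices that appear in this cyclic order on a face of $G$, that is, some closed topological disc is contained in that face except for four points of its boundary circle, which are, in this cyclic order, $a_1,b_1,a_2,b_2$. (i) If $\{a_1,b_2\}\subseteq U$ and $\{a_2,b_1\}\subseteq V$, or $\{a_1,b_2\}\subseteq V$ and $\{a_2,b_1\}\subseteq U$, then $$M(G)\,M(G-a_1-b_1-e)=M(G-a_1-b_1)\,M(G-e)+\omega_e\,M(G-a_1-a_2)\,M(G-b_1-b_2).$$ (ii) If $\{a_1,a_2\}\subseteq U$ and $\{b_1,b_2\}\subseteq V$, or $\{a_1,a_2\}\subseteq V$ and $\{b_1,b_2\}\subseteq U$, then $$M(G)\,M(G-a_1-b_1-e)=M(G-a_1-b_1)\,M(G-e)-\omega_e\,M(G-a_2-b_1)\,M(G-a_1-b_2).$$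 -/

import Mathlib

/-- A drawing of a simple graph `G` in the plane `ℂ` without crossings; a graph together with such
a drawing is a plane graph.  The values of `arc` off the edge set of `G` play no role. -/
structure PlaneDrawing {α : Type*} (G : SimpleGraph α) where
  /-- the point that represents a vertex -/
  pos : α → ℂ
  /-- the set of points (end points included) that represents an edge -/
  arc : Sym2 α → Set ℂ
  pos_injective : Function.Injective pos
  /-- every edge is a simple arc that joins its two end vertices -/
  isArc : ∀ u v, G.Adj u v →
    ∃ γ : Path (pos u) (pos v), Function.Injective γ ∧ Set.range γ = arc s(u, v)
  /-- an edge passes through no vertex other than its end vertices -/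
  mem_of_pos_mem_arc : ∀ e ∈ G.edgeSet, ∀ v, pos v ∈ arc e → v ∈ e
  /-- two different edges meet at most in vertices -/
  arc_inter_arc_subset : ∀ e ∈ G.edgeSet, ∀ f ∈ G.edgeSet, e ≠ f → arc e ∩ arc f ⊆ Set.range pos

namespace PlaneDrawing

variable {α : Type*} {G : SimpleGraph α}

/-- The set of all points of the plane that lie on the drawing. -/
def support (D : PlaneDrawing G) : Set ℂ :=
  Set.range D.pos ∪ ⋃ e ∈ G.edgeSet, D.arc e

/-- The faces are the connected components of the complement of the drawing. -/
def IsFace (D : PlaneDrawing G) (F : Set ℂ) : Prop :=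
  ∃ x ∈ D.supportᶜ, F = connectedComponentIn D.supportᶜ x

/-- The vertices `a, b, c, d` appear in this cyclic order (clockwise or counterclockwise) on the
face `F`: some closed topological disc lies in `F` except for four points of its boundary circle,
and these four points are, in cyclic order, the vertices `a, b, c, d`.
If the boundary of `F` is a simple closed curve, this says that `a, b, c, d` are four different
points of that curve in this cyclic order; in general it says that they occur in this cyclic order
at four corners of `F` met on going round the boundary of `F` (a vertex may have several
corners in `F`). The disc cannot be replaced by its boundary circle alone, because a closed curve
whose arcs lie in `F` can have parts of the graph on both of its sides. -/
def CyclicOnFace (D : PlaneDrawing G) (F : Set ℂ) (a b c d : α) : Prop :=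
  ∃ h : ℂ → ℂ,
    ContinuousOn h (Metric.closedBall 0 1) ∧
    Set.InjOn h (Metric.closedBall 0 1) ∧
    h 1 = D.pos a ∧ h Complex.I = D.pos b ∧ h (-1) = D.pos c ∧ h (-Complex.I) = D.pos d ∧
    ∀ z ∈ Metric.closedBall (0 : ℂ) 1,
      z ∉ ({1, Complex.I, -1, -Complex.I} : Set ℂ) → h z ∈ F

end PlaneDrawing

/-- `P` is a perfect matching of the graph `H`: a set of independent edges of `H` covering all
vertices of `H`. Here `H` is given as a subgraph of an ambient graph `G`. -/
structure IsPerfectMatchingSet {α : Type*} {G : SimpleGraph α} (H : G.Subgraph)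
    (P : Finset (Sym2 α)) : Prop where
  subset_edgeSet : ∀ e ∈ P, e ∈ H.edgeSet
  independent : ∀ e ∈ P, ∀ f ∈ P, e ≠ f → ∀ v, v ∈ e → v ∉ f
  covers : ∀ v ∈ H.verts, ∃ e ∈ P, v ∈ e

open Classical in
/-- `M(H)`: the sum, over the perfect matchings of `H`, of the product of the weights of the edges
of the matching. The weight of the edge `e` is `w e`. -/
noncomputable def matchingSum {α : Type*} [Fintype α] {R : Type*} [CommRing R]
    {G : SimpleGraph α} (w : Sym2 α → R) (H : G.Subgraph) : R :=
  ∑ P : Finset (Sym2 α) with IsPerfectMatchingSet H P, ∏ e ∈ P, w e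

/-! Split the perfect matchings of `G` and of `G - a₁ - b₁` according to whether they contain `e`.
The terms free of `ω_e` then cancel, so that `M(G) M(G-a₁-b₁-e) - M(G-a₁-b₁) M(G-e)` equals `ω_e`
times `M(G-a₂-b₂) M(G-a₁-b₁) - M(G) M(G-a₁-b₁-a₂-b₂)`. Kuo condensation evaluates the last
difference.

For Kuo condensation, write `a, b, c, d` for the four vertices and superpose a matching `P` of `G -
X` and a matching `Q` of `G - Y`, where `X` and `Y` partition them. The component of `a` in `P ∪ Q`
contains exactly one other of the four (`exists_filter_comp_eq_pair`): counting edges gives at most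
one, counting colours at least one. It is not `c`, since then the component of `b` would contain
`d`, and two disjoint walks would join opposite vertices of a face. Exchanging `P` and `Q` on this
component preserves the total weight and moves the two vertices between `X` and `Y`
(`pairSum_symmDiff`). Colours exclude some of the types (`pairSum_eq_zero`), and comparing the
remaining ones gives both identities.

The crossing property (`not_disjoint_paths_of_disc`) is proved with winding numbers. Close the two
paths by the two diameters of the disc. The difference of a point on one closed curve and a point on
the other is a function on a torus made of four squares. If the paths were disjoint, it would vanish
on none of the three squares other than diameter times diameter, so its winding number round the
boundary of that square would be zero. But there `h s - h t` deforms to an odd function, whose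
winding number cannot be zero (`logVar_boundary_ne_zero`). -/

open unitInterval

/-! ### Continuous logarithms and their variation -/

/-- A continuous nowhere vanishing function on the unit square has a continuous logarithm. -/
theorem exists_continuous_log_square (f : I × I → ℂ) (hf : Continuous f) (h0 : ∀ x, f x ≠ 0) :
    ∃ l : I × I → ℂ, Continuous l ∧ ∀ x, Complex.exp (l x) = f x := by
  -- Composing with the retraction of the plane onto the square gives a map on the simply connected
  -- plane, which lifts through `exp`.
  let r : ℝ × ℝ → I × I := Prod.map (Set.projIcc 0 1 zero_le_one) (Set.projIcc 0 1 zero_le_one)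
  have hr : Continuous r := continuous_projIcc.prodMap continuous_projIcc
  obtain ⟨F, ⟨-, hF⟩, -⟩ := Complex.isCoveringMapOn_exp.existsUnique_continuousMap_lifts
    (⟨f ∘ r, hf.comp hr⟩ : C(ℝ × ℝ, ℂ)) (a₀ := (0, 0))
    (Complex.exp_log (h0 (r (0, 0)))) (fun x ↦ h0 (r x))
  refine ⟨fun x ↦ F (x.1, x.2), by fun_prop, fun x ↦ ?_⟩
  have := congrFun hF ((x.1 : ℝ), (x.2 : ℝ))
  simpa [r] using this

/-- `v` is the total variation along `f` of a continuous logarithm of `f`. -/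
def IsLogVar (f : I → ℂ) (v : ℂ) : Prop :=
  ∃ l : I → ℂ, Continuous l ∧ (∀ x, Complex.exp (l x) = f x) ∧ v = l 1 - l 0

/-- The difference `l - m` lifts a constant map through the covering `exp`; as `I` is connected,
uniqueness of lifts makes it constant. -/
theorem sub_eq_sub_of_exp_eq_mul {l m : I → ℂ} (hl : Continuous l) (hm : Continuous m) (c : ℂ)
    (h : ∀ x, Complex.exp (l x) = c * Complex.exp (m x)) : l 1 - l 0 = m 1 - m 0 := by
  have hc : ∀ x, Complex.exp (l x - m x) = c := fun x ↦ by
    rw [Complex.exp_sub, h, mul_div_cancel_right₀ _ (Complex.exp_ne_zero _)]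
  have hc0 : c ≠ 0 := by rw [← hc 0]; exact Complex.exp_ne_zero _
  have key := Complex.isCoveringMap_exp.eq_of_comp_eq (A := I) (g₁ := fun x ↦ l x - m x)
    (g₂ := fun _ ↦ l 0 - m 0) (by fun_prop) (by fun_prop)
    (by ext x; simp [hc]) 0 rfl
  have := congrFun key 1
  linear_combination this

theorem IsLogVar.unique {f : I → ℂ} {v v' : ℂ} (h : IsLogVar f v) (h' : IsLogVar f v') :
    v = v' := by
  obtain ⟨l, hl, hle, rfl⟩ := h
  obtain ⟨m, hm, hme, rfl⟩ := h'
  exact sub_eq_sub_of_exp_eq_mul hl hm 1 (by simp [hle, hme])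

theorem IsLogVar.exp_eq {f : I → ℂ} {v : ℂ} (h : IsLogVar f v) :
    Complex.exp v = f 1 / f 0 := by
  obtain ⟨l, hl, hle, rfl⟩ := h
  rw [Complex.exp_sub, hle, hle]

/-- Reversal of the parameter changes the sign of the variation; the factor `-1` only shifts the
logarithm by `π i`. -/
theorem IsLogVar.neg_symm {f g : I → ℂ} {v : ℂ} (h : IsLogVar f v) (hg : ∀ x, g x = -f (σ x)) :
    IsLogVar g (-v) := by
  obtain ⟨l, hl, hle, rfl⟩ := h
  refine ⟨fun x ↦ l (σ x) + Real.pi * Complex.I, by fun_prop, fun x ↦ ?_, by simp⟩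
  rw [Complex.exp_add, hle, Complex.exp_pi_mul_I, hg]; ring

theorem exists_isLogVar (f : I → ℂ) (hf : Continuous f) (h0 : ∀ x, f x ≠ 0) :
    ∃ v, IsLogVar f v := by
  obtain ⟨l, hl, hle⟩ := exists_continuous_log_square (fun x ↦ f x.1) (by fun_prop) (fun x ↦ h0 _)
  exact ⟨_, fun x ↦ l (x, 0), by fun_prop, fun x ↦ hle _, rfl⟩

/-- The variations of the logarithm along the four sides of a square add up to zero. -/
theorem IsLogVar.square {f : I → I → ℂ} (hf : Continuous fun x : I × I ↦ f x.1 x.2)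
    (h0 : ∀ x y, f x y ≠ 0) {b r t l : ℂ} (hb : IsLogVar (fun x ↦ f x 0) b)
    (hr : IsLogVar (fun y ↦ f 1 y) r) (ht : IsLogVar (fun x ↦ f x 1) t)
    (hl : IsLogVar (fun y ↦ f 0 y) l) : b + r = l + t := by
  obtain ⟨m, hm, hme⟩ := exists_continuous_log_square _ hf (fun x ↦ h0 _ _)
  rw [hb.unique ⟨fun x ↦ m (x, 0), by fun_prop, fun x ↦ hme _, rfl⟩,
    hr.unique ⟨fun y ↦ m (1, y), by fun_prop, fun x ↦ hme _, rfl⟩,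
    ht.unique ⟨fun x ↦ m (x, 1), by fun_prop, fun x ↦ hme _, rfl⟩,
    hl.unique ⟨fun y ↦ m (0, y), by fun_prop, fun x ↦ hme _, rfl⟩]
  ring

/-! ### Winding numbers of differences on the disc -/

/-- The affine bijection from `[0, 1]` to `[-1, 1]`, with values in the complex numbers. -/
noncomputable def diam (x : I) : ℂ := 2 * (x : ℝ) - 1

@[fun_prop]
theorem continuous_diam : Continuous diam := by unfold diam; fun_prop

@[simp] theorem diam_zero : diam 0 = -1 := by simp [diam]

@[simp] theorem diam_one : diam 1 = 1 := by simp [diam]; norm_num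

theorem diam_symm (x : I) : diam (σ x) = -diam x := by simp [diam]; ring

theorem norm_diam_le (x : I) : ‖diam x‖ ≤ 1 := by
  have : diam x = ((2 * (x : ℝ) - 1 : ℝ) : ℂ) := by simp [diam]
  rw [this, Complex.norm_real, Real.norm_eq_abs, abs_le]
  constructor <;> linarith [x.2.1, x.2.2]

theorem diam_im (x : I) : (diam x).im = 0 := by simp [diam]

/-- Two points of the disc with difference `s - t`: for `k = 0` they are `s` and `t`, and for
`k = 1` they are antipodal. -/
noncomputable def spread (k : I) (s t : ℂ) : ℂ := s - (k : ℝ) * ((s + t) / 2)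

theorem norm_spread_le (k : I) {s t : ℂ} (hs : ‖s‖ ≤ 1) (ht : ‖t‖ ≤ 1) : ‖spread k s t‖ ≤ 1 := by
  have : spread k s t = ((1 - k / 2 : ℝ) : ℂ) * s + ((-(k / 2) : ℝ) : ℂ) * t := by
    simp [spread]; ring
  rw [this]
  refine (norm_add_le _ _).trans ?_
  have h0 := k.2.1
  have h1 := k.2.2
  rw [norm_mul, norm_mul, Complex.norm_real, Complex.norm_real, Real.norm_eq_abs, Real.norm_eq_abs,
    abs_of_nonneg (by linarith), abs_neg, abs_of_nonneg (by linarith)]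
  nlinarith

theorem spread_sub_spread (k : I) (s t : ℂ) : spread k s t - spread k t s = s - t := by
  simp [spread]; ring

/-- The difference of the two spread points is `s - t` for every `k`, so distinct points stay
distinct during the deformation, and `h` is injective. -/
theorem sub_spread_ne_zero {h : ℂ → ℂ} (hi : Set.InjOn h (Metric.closedBall 0 1)) (k : I)
    {s t : ℂ} (hs : ‖s‖ ≤ 1) (ht : ‖t‖ ≤ 1) (hst : s ≠ t) :
    h (spread k s t) - h (spread k t s) ≠ 0 := by
  intro h0
  have := hi (by simpa using norm_spread_le k hs ht) (by simpa using norm_spread_le k ht hs)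
    (sub_eq_zero.1 h0)
  exact hst (sub_eq_zero.1 (by rw [← spread_sub_spread k, this, sub_self]))

theorem continuous_sub_spread {h : ℂ → ℂ} (hc : ContinuousOn h (Metric.closedBall 0 1))
    {X : Type*} [TopologicalSpace X] {k : X → I} {s t : X → ℂ}
    (hk : Continuous k) (hsc : Continuous s) (htc : Continuous t)
    (hs : ∀ x, ‖s x‖ ≤ 1) (ht : ∀ x, ‖t x‖ ≤ 1) :
    Continuous fun x ↦ h (spread (k x) (s x) (t x)) - h (spread (k x) (t x) (s x)) := by
  refine Continuous.sub ?_ ?_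
  · refine hc.comp_continuous (by unfold spread; fun_prop) fun x ↦ ?_
    simpa using norm_spread_le (k x) (hs x) (ht x)
  · refine hc.comp_continuous (by unfold spread; fun_prop) fun x ↦ ?_
    simpa using norm_spread_le (k x) (ht x) (hs x)

@[simp] theorem spread_zero (s t : ℂ) : spread 0 s t = s := by simp [spread]

theorem spread_one_neg (s t : ℂ) : spread 1 (-s) (-t) = spread 1 t s := by simp [spread]; ring

theorem ne_of_im_eq_zero {s t : ℂ} (hs : s ≠ 0) (hi : s.im = 0) (hr : t.re = 0) : s ≠ t := by
  rintro rfl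
  exact hs (Complex.ext hr hi)

theorem I_mul_diam_re (x : I) : (Complex.I * diam x).re = 0 := by simp [diam_im]

theorem norm_I_mul_diam_le (x : I) : ‖Complex.I * diam x‖ ≤ 1 := by simpa using norm_diam_le x

theorem ne_of_re_eq_zero {s t : ℂ} (ht : t ≠ 0) (hi : s.im = 0) (hr : t.re = 0) : s ≠ t := by
  rintro rfl
  exact ht (Complex.ext hr hi)

/-- For an injective continuous `h` on the disc, the difference `h s - h t` has non-zero winding
number when the point `(s, t)` goes round the boundary of the square that is the product of the
horizontal and the vertical diameter. -/
theorem logVar_boundary_ne_zero {h : ℂ → ℂ} (hc : ContinuousOn h (Metric.closedBall 0 1))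
    (hi : Set.InjOn h (Metric.closedBall 0 1)) {b r t l : ℂ}
    (hb : IsLogVar (fun x ↦ h (diam x) - h (-Complex.I)) b)
    (ht : IsLogVar (fun x ↦ h (diam x) - h Complex.I) t)
    (hr : IsLogVar (fun y ↦ h 1 - h (Complex.I * diam y)) r)
    (hl : IsLogVar (fun y ↦ h (-1) - h (Complex.I * diam y)) l) : b + r ≠ t + l := by
  let S : I → ℂ → ℂ → ℂ := fun k s t ↦ h (spread k s t) - h (spread k t s)
  -- A non-zero point of one axis never equals a point of the other, so on all four sides of the
  -- square the deformation in `k` avoids zero.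
  have hor : ∀ e : ℂ, ‖e‖ = 1 → e.re = 0 →
      (Continuous fun x : I × I ↦ S x.2 (diam x.1) e) ∧ ∀ x k, S k (diam x) e ≠ 0 := by
    intro e he hre
    have he0 : e ≠ 0 := by rintro rfl; simp at he
    exact ⟨continuous_sub_spread hc (by fun_prop) (by fun_prop) (by fun_prop)
      (fun _ ↦ norm_diam_le _) (fun _ ↦ he.le), fun x k ↦ sub_spread_ne_zero hi k (norm_diam_le x)
      he.le (ne_of_re_eq_zero he0 (diam_im x) hre)⟩
  have ver : ∀ e : ℂ, ‖e‖ = 1 → e.im = 0 →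
      (Continuous fun x : I × I ↦ S x.2 e (Complex.I * diam x.1)) ∧
        ∀ x k, S k e (Complex.I * diam x) ≠ 0 := by
    intro e he him
    have he0 : e ≠ 0 := by rintro rfl; simp at he
    exact ⟨continuous_sub_spread hc (by fun_prop) (by fun_prop) (by fun_prop)
      (fun _ ↦ he.le) (fun _ ↦ norm_I_mul_diam_le _), fun x k ↦ sub_spread_ne_zero hi k he.le
      (norm_I_mul_diam_le x) (ne_of_im_eq_zero he0 him (I_mul_diam_re x))⟩
  obtain ⟨bc, b0⟩ := hor (-Complex.I) (by simp) (by simp)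
  obtain ⟨tc, t0⟩ := hor Complex.I (by simp) (by simp)
  obtain ⟨lc, l0⟩ := ver (-1) (by simp) (by simp)
  obtain ⟨rc, r0⟩ := ver 1 (by simp) (by simp)
  have emb (x : I) : Continuous fun k : I ↦ (x, k) := by fun_prop
  have emb' (k : I) : Continuous fun x : I ↦ (x, k) := by fun_prop
  obtain ⟨cmm, hmm⟩ := exists_isLogVar _ (bc.comp (emb 0)) (fun k ↦ b0 0 k)
  obtain ⟨cpm, hpm⟩ := exists_isLogVar _ (bc.comp (emb 1)) (fun k ↦ b0 1 k)
  obtain ⟨cmp, hmp⟩ := exists_isLogVar _ (tc.comp (emb 0)) (fun k ↦ t0 0 k)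
  obtain ⟨cpp, hpp⟩ := exists_isLogVar _ (tc.comp (emb 1)) (fun k ↦ t0 1 k)
  obtain ⟨b1, hb1⟩ := exists_isLogVar _ (bc.comp (emb' 1)) (fun x ↦ b0 x 1)
  obtain ⟨l1, hl1⟩ := exists_isLogVar _ (lc.comp (emb' 1)) (fun x ↦ l0 x 1)
  simp only [Function.comp_def, diam_zero, diam_one] at hmm hpm hmp hpp hb1 hl1
  -- At `k = 1` the two points are `(s - t) / 2` and its negative, so the antipodal map of the
  -- square changes the sign of `S 1`. Opposite sides therefore have opposite variations once
  -- traversed in the same direction.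
  have odd : ∀ s t, S 1 (-s) (-t) = -S 1 s t := fun s t ↦ by
    simp only [S, spread_one_neg, neg_sub]
  have ht1 : IsLogVar (fun x ↦ S 1 (diam x) Complex.I) (-b1) := hb1.neg_symm fun x ↦ by
    rw [← odd, diam_symm, neg_neg, neg_neg]
  have hr1 : IsLogVar (fun x ↦ S 1 1 (Complex.I * diam x)) (-l1) := hl1.neg_symm fun x ↦ by
    rw [← odd, diam_symm, neg_neg, mul_neg, neg_neg]
  -- The deformation sweeps out one square for each side; in the total the variations at the four
  -- corners cancel.
  have e1 := IsLogVar.square bc b0 (b := b) (by simpa [S] using hb) (by simpa using hpm) hb1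
    (by simpa using hmm)
  have e2 := IsLogVar.square tc t0 (b := t) (by simpa [S] using ht) (by simpa using hpp) ht1
    (by simpa using hmp)
  have e3 := IsLogVar.square lc l0 (b := l) (by simpa [S] using hl) (by simpa using hmp) hl1
    (by simpa using hmm)
  have e4 := IsLogVar.square rc r0 (b := r) (by simpa [S] using hr) (by simpa using hpp) hr1
    (by simpa using hpm)
  intro hsum
  -- The winding at `k = 1` is `2 * (b1 - l1)`. If it is zero, exponentiating gives `S 1 1 (-i) = S
  -- 1 (-1) i`, and oddness forces this value to be zero.
  have h1 : b1 = l1 := by linear_combination (1 / 2) * (hsum + e2 + e3 - e1 - e4)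
  have h2 := hb1.exp_eq
  rw [h1, hl1.exp_eq] at h2
  simp only [diam_zero, diam_one, mul_neg, mul_one] at h2
  have h3 : S 1 (-1) (-Complex.I) ≠ 0 := by simpa using b0 0 1
  have h4 : S 1 1 (-Complex.I) ≠ 0 := by simpa using b0 1 1
  have h5 := (div_left_inj' h3).1 h2
  rw [← neg_neg Complex.I, odd, neg_neg] at h5
  exact h4 (by linear_combination (-1 / 2) * h5)

/-- Two disjoint paths outside a closed topological disc cannot join two pairs of boundary points
of the disc that separate each other on the boundary. -/
theorem not_disjoint_paths_of_disc {h : ℂ → ℂ} (hc : ContinuousOn h (Metric.closedBall 0 1))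
    (hi : Set.InjOn h (Metric.closedBall 0 1)) (P : Path (h 1) (h (-1)))
    (Q : Path (h Complex.I) (h (-Complex.I))) (hPQ : ∀ x y, P x ≠ Q y)
    (hP : ∀ x y, P x ≠ h (Complex.I * diam y)) (hQ : ∀ x y, h (diam x) ≠ Q y) : False := by
  have cd : Continuous fun x ↦ h (diam x) :=
    hc.comp_continuous continuous_diam fun x ↦ by simpa using norm_diam_le x
  have cv : Continuous fun x ↦ h (Complex.I * diam x) :=
    hc.comp_continuous (by fun_prop) fun x ↦ by simpa using norm_diam_le x
  have c1 : Continuous fun x : I × I ↦ P x.1 - Q x.2 := by fun_prop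
  have c2 : Continuous fun x : I × I ↦ P x.1 - h (Complex.I * diam x.2) :=
    (P.continuous.comp continuous_fst).sub (cv.comp continuous_snd)
  have c3 : Continuous fun x : I × I ↦ h (diam x.1) - Q x.2 :=
    (cd.comp continuous_fst).sub (Q.continuous.comp continuous_snd)
  have n1 : ∀ x y, P x - Q y ≠ 0 := fun x y ↦ sub_ne_zero.2 (hPQ x y)
  have n2 : ∀ x y, P x - h (Complex.I * diam y) ≠ 0 := fun x y ↦ sub_ne_zero.2 (hP x y)
  have n3 : ∀ x y, h (diam x) - Q y ≠ 0 := fun x y ↦ sub_ne_zero.2 (hQ x y)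
  have emb (x : I) : Continuous fun k : I ↦ (x, k) := by fun_prop
  have emb' (k : I) : Continuous fun x : I ↦ (x, k) := by fun_prop
  obtain ⟨p0, hp0⟩ := exists_isLogVar _ (c1.comp (emb' 0)) (fun x ↦ n1 x 0)
  obtain ⟨p1, hp1⟩ := exists_isLogVar _ (c1.comp (emb' 1)) (fun x ↦ n1 x 1)
  obtain ⟨q0, hq0⟩ := exists_isLogVar _ (c1.comp (emb 0)) (fun x ↦ n1 0 x)
  obtain ⟨q1, hq1⟩ := exists_isLogVar _ (c1.comp (emb 1)) (fun x ↦ n1 1 x)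
  obtain ⟨t, ht⟩ := exists_isLogVar _ (c3.comp (emb' 0)) (fun x ↦ n3 x 0)
  obtain ⟨b, hb⟩ := exists_isLogVar _ (c3.comp (emb' 1)) (fun x ↦ n3 x 1)
  obtain ⟨r, hr⟩ := exists_isLogVar _ (c2.comp (emb 0)) (fun x ↦ n2 0 x)
  obtain ⟨l, hl⟩ := exists_isLogVar _ (c2.comp (emb 1)) (fun x ↦ n2 1 x)
  simp only [Function.comp_def] at hp0 hp1 hq0 hq1 ht hb hr hl
  -- These are the squares path × path, path × diameter and diameter × path. Their sides that do not
  -- bound the square diameter × diameter cancel in pairs.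
  have e1 := IsLogVar.square c1 n1 hp0 hq1 hp1 hq0
  have e2 := IsLogVar.square c2 n2 (b := p1) (by simpa using hp1) hl (t := p0) (by simpa using hp0) hr
  have e3 := IsLogVar.square c3 n3 ht (r := q0) (by simpa using hq0) hb (l := q1) (by simpa using hq1)
  refine logVar_boundary_ne_zero hc hi (by simpa using hb) (by simpa using ht) (by simpa using hr)
    (by simpa using hl) ?_
  linear_combination -e1 - e2 - e3
-- Walks in a plane drawing
open unitInterval

namespace PlaneDrawing

variable {α : Type*} {G : SimpleGraph α} (D : PlaneDrawing G)

/-- The part of the drawing that represents a walk. -/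
def walkSet {u v : α} (p : G.Walk u v) : Set ℂ :=
  {z | (∃ w ∈ p.support, z = D.pos w) ∨ ∃ e ∈ p.edges, z ∈ D.arc e}

theorem exists_path_of_walk {u v : α} (p : G.Walk u v) :
    ∃ γ : Path (D.pos u) (D.pos v), ∀ x, γ x ∈ D.walkSet p := by
  induction p with
  | nil => exact ⟨Path.refl _, fun x ↦ Or.inl ⟨_, by simp, rfl⟩⟩
  | @cons u v w h p ih =>
    obtain ⟨γ, hγ⟩ := ih
    obtain ⟨δ, -, hδ⟩ := D.isArc u v h
    refine ⟨δ.trans γ, fun x ↦ ?_⟩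
    have hx : δ.trans γ x ∈ Set.range δ ∪ Set.range γ := by
      rw [← Path.trans_range]; exact ⟨x, rfl⟩
    rcases hx with hx | ⟨y, hy⟩
    · exact Or.inr ⟨s(u, v), by simp, hδ ▸ hx⟩
    · rw [← hy]
      rcases hγ y with ⟨z, hz, hzy⟩ | ⟨e, he, hey⟩
      · exact Or.inl ⟨z, by simp [hz], hzy⟩
      · exact Or.inr ⟨e, by simp [he], hey⟩

theorem walkSet_subset_support {u v : α} (p : G.Walk u v) : D.walkSet p ⊆ D.support := by
  rintro z (⟨w, -, rfl⟩ | ⟨e, he, hz⟩)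
  · exact Or.inl ⟨w, rfl⟩
  · exact Or.inr (Set.mem_biUnion (p.edges_subset_edgeSet he) hz)

theorem mem_support_of_pos_mem_walkSet {u v w : α} {p : G.Walk u v}
    (hw : D.pos w ∈ D.walkSet p) : w ∈ p.support := by
  rcases hw with ⟨z, hz, h⟩ | ⟨e, he, h⟩
  · rwa [D.pos_injective h]
  · exact p.mem_support_of_mem_edges he
      (D.mem_of_pos_mem_arc e (p.edges_subset_edgeSet he) w h)

/-- Different edges meet only in vertices, so a common point would be a vertex, or lie on a common
edge, whose ends belong to both walks. -/
theorem disjoint_walkSet {a b c d : α} {p : G.Walk a b} {q : G.Walk c d}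
    (h : ∀ v ∈ p.support, v ∉ q.support) : Disjoint (D.walkSet p) (D.walkSet q) := by
  rw [Set.disjoint_left]
  rintro z hp hq
  have key : ∀ w, z ≠ D.pos w := by
    rintro w rfl
    exact h w (D.mem_support_of_pos_mem_walkSet hp) (D.mem_support_of_pos_mem_walkSet hq)
  rcases hp with ⟨w, -, hw⟩ | ⟨e, he, hze⟩
  · exact key w hw
  rcases hq with ⟨w, -, hw⟩ | ⟨f, hf, hzf⟩
  · exact key w hw
  have hne : e ≠ f := by
    rintro rfl
    induction e with
    | _ x y =>
      exact h x (p.fst_mem_support_of_mem_edges he) (q.fst_mem_support_of_mem_edges hf)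
  obtain ⟨w, hw⟩ := D.arc_inter_arc_subset e (p.edges_subset_edgeSet he) f
    (q.edges_subset_edgeSet hf) hne ⟨hze, hzf⟩
  exact key w hw.symm

theorem IsFace.disjoint_support {D : PlaneDrawing G} {F : Set ℂ} (hF : D.IsFace F) :
    Disjoint F D.support := by
  obtain ⟨x, -, rfl⟩ := hF
  exact Set.disjoint_left.2 fun z hz ↦ connectedComponentIn_subset _ _ hz

/-- Walks that join two pairs of vertices that separate each other on a face have a common
vertex. -/
theorem CyclicOnFace.exists_mem_support {D : PlaneDrawing G} {F : Set ℂ} (hF : D.IsFace F)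
    {a b c d : α} (hcyc : D.CyclicOnFace F a b c d) (p : G.Walk a c) (q : G.Walk b d) :
    ∃ v ∈ p.support, v ∈ q.support := by
  by_contra! hpq
  obtain ⟨h, hc, hi, h1, hI, h1', hI', hin⟩ := hcyc
  obtain ⟨P, hP⟩ := D.exists_path_of_walk p
  obtain ⟨Q, hQ⟩ := D.exists_path_of_walk q
  have hdisj := Set.disjoint_left.1 (D.disjoint_walkSet hpq)
  have hFs := Set.disjoint_left.1 hF.disjoint_support
  refine not_disjoint_paths_of_disc hc hi (P.cast h1 h1') (Q.cast hI hI') (fun x y hxy ↦ ?_)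
    (fun x y hxy ↦ ?_) (fun x y hxy ↦ ?_)
  · simp only [Path.cast_coe] at hxy
    exact hdisj (hP x) (hxy ▸ hQ y)
  · simp only [Path.cast_coe] at hxy
    have hx := hP x
    rw [hxy] at hx
    -- Inside the face the diameter misses the drawing; its end points are `b` and `d`, which lie on
    -- `q` and hence not on `p`.
    by_cases hs : Complex.I * diam y ∈ ({1, Complex.I, -1, -Complex.I} : Set ℂ)
    · have hre := I_mul_diam_re y
      rcases hs with hs | hs | hs | hs
      · simp [hs] at hre
      · rw [hs, hI] at hx
        exact hpq _ (D.mem_support_of_pos_mem_walkSet hx) q.start_mem_support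
      · simp [hs] at hre
      · rw [hs, hI'] at hx
        exact hpq _ (D.mem_support_of_pos_mem_walkSet hx) q.end_mem_support
    · exact hFs (hin _ (by simpa using norm_diam_le y) hs) (D.walkSet_subset_support p hx)
  · simp only [Path.cast_coe] at hxy
    have hy := hQ y
    rw [← hxy] at hy
    by_cases hs : diam x ∈ ({1, Complex.I, -1, -Complex.I} : Set ℂ)
    · have him := diam_im x
      rcases hs with hs | hs | hs | hs
      · rw [hs, h1] at hy
        exact hpq _ p.start_mem_support (D.mem_support_of_pos_mem_walkSet hy)
      · simp [hs] at him
      · rw [hs, h1'] at hy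
        exact hpq _ p.end_mem_support (D.mem_support_of_pos_mem_walkSet hy)
      · rw [hs] at him
        simp at him
    · exact hFs (hin _ (by simpa using norm_diam_le x) hs) (D.walkSet_subset_support q hy)

theorem CyclicOnFace.pairwise_ne {D : PlaneDrawing G} {F : Set ℂ}
    {a b c d : α} (hcyc : D.CyclicOnFace F a b c d) :
    a ≠ b ∧ a ≠ c ∧ a ≠ d ∧ b ≠ c ∧ b ≠ d ∧ c ≠ d := by
  obtain ⟨h, -, hi, h1, hI, h1', hI', -⟩ := hcyc
  refine ⟨?_, ?_, ?_, ?_, ?_, ?_⟩ <;> rintro rfl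
  · have := hi (by simp) (by simp) (h1.trans hI.symm)
    simp [Complex.ext_iff] at this
  · have := hi (by simp) (by simp) (h1.trans h1'.symm)
    norm_num [Complex.ext_iff] at this
  · have := hi (by simp) (by simp) (h1.trans hI'.symm)
    simp [Complex.ext_iff] at this
  · have := hi (by simp) (by simp) (hI.trans h1'.symm)
    simp [Complex.ext_iff] at this
  · have := hi (by simp) (by simp) (hI.trans hI'.symm)
    norm_num [Complex.ext_iff] at this
  · have := hi (by simp) (by simp) (h1'.trans hI'.symm)
    simp [Complex.ext_iff] at this

end PlaneDrawing

/-! ### Superposition of two matchings and exchange on a component -/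

section Matchings

open scoped Classical symmDiff

variable {α : Type*} {G : SimpleGraph α}

/-- `P` is a perfect matching of the graph `G - X`. -/
structure IsMatchingOff (G : SimpleGraph α) (X : Finset α) (P : Finset (Sym2 α)) : Prop where
  mem_edgeSet : ∀ e ∈ P, e ∈ G.edgeSet
  notMem : ∀ e ∈ P, ∀ v ∈ e, v ∉ X
  eq_of_mem : ∀ e ∈ P, ∀ f ∈ P, ∀ v, v ∈ e → v ∈ f → e = f
  covers : ∀ v, v ∉ X → ∃ e ∈ P, v ∈ e

theorem isPerfectMatchingSet_deleteVerts_iff {X : Finset α} {P : Finset (Sym2 α)} :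
    IsPerfectMatchingSet ((⊤ : G.Subgraph).deleteVerts X) P ↔ IsMatchingOff G X P := by
  have hmem : ∀ e : Sym2 α, e ∈ ((⊤ : G.Subgraph).deleteVerts X).edgeSet ↔
      e ∈ G.edgeSet ∧ ∀ v ∈ e, v ∉ X := by
    intro e
    induction e with
    | _ u v => simp; tauto
  constructor
  · rintro ⟨h1, h2, h3⟩
    refine ⟨fun e he ↦ ((hmem e).1 (h1 e he)).1, fun e he ↦ ((hmem e).1 (h1 e he)).2, ?_, ?_⟩
    · intro e he f hf v hve hvf
      by_contra hne
      exact h2 e he f hf hne v hve hvf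
    · intro v hv
      exact h3 v (by simpa using hv)
  · rintro ⟨h1, h2, h3, h4⟩
    refine ⟨fun e he ↦ (hmem e).2 ⟨h1 e he, h2 e he⟩, ?_, ?_⟩
    · intro e he f hf hne v hve hvf
      exact hne (h3 e he f hf v hve hvf)
    · intro v hv
      exact h4 v (by simpa using hv)

/-- No edge of `P` leaves the set `C`. -/
def EdgeClosed (P : Finset (Sym2 α)) (C : Set α) : Prop :=
  ∀ e ∈ P, ∀ u ∈ e, ∀ v ∈ e, u ∈ C → v ∈ C

/-- The edge `e` has an end vertex in `C`. -/
def Meets (C : Set α) (e : Sym2 α) : Prop := ∃ v ∈ e, v ∈ C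

/-- Replace the edges of `P` that meet `C` by those of `Q`. -/
noncomputable def swapOn (C : Set α) (P Q : Finset (Sym2 α)) : Finset (Sym2 α) :=
  {e ∈ P | ¬ Meets C e} ∪ {e ∈ Q | Meets C e}

theorem mem_swapOn {C : Set α} {P Q : Finset (Sym2 α)} {e : Sym2 α} :
    e ∈ swapOn C P Q ↔ (e ∈ P ∧ ¬ Meets C e) ∨ (e ∈ Q ∧ Meets C e) := by
  simp [swapOn]

theorem swapOn_union_swapOn (C : Set α) (P Q : Finset (Sym2 α)) :
    swapOn C P Q ∪ swapOn C Q P = P ∪ Q := by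
  ext e
  simp only [Finset.mem_union, mem_swapOn]
  tauto

theorem swapOn_swapOn (C : Set α) (P Q : Finset (Sym2 α)) :
    swapOn C (swapOn C P Q) (swapOn C Q P) = P := by
  ext e
  simp only [mem_swapOn]
  tauto

theorem prod_swapOn_mul_prod_swapOn {R : Type*} [CommRing R] (w : Sym2 α → R) (C : Set α)
    (P Q : Finset (Sym2 α)) :
    (∏ e ∈ swapOn C P Q, w e) * ∏ e ∈ swapOn C Q P, w e = (∏ e ∈ P, w e) * ∏ e ∈ Q, w e := by
  have hd : ∀ P Q : Finset (Sym2 α), Disjoint {e ∈ P | ¬ Meets C e} {e ∈ Q | Meets C e} := by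
    intro P Q
    rw [Finset.disjoint_left]
    simp only [Finset.mem_filter]
    tauto
  rw [swapOn, swapOn, Finset.prod_union (hd P Q), Finset.prod_union (hd Q P),
    ← Finset.prod_filter_mul_prod_filter_not P (Meets C),
    ← Finset.prod_filter_mul_prod_filter_not Q (Meets C)]
  ring

/-- No edge of `P` or `Q` crosses the boundary of `C`, so the new set is `Q` on `C` and `P` off `C`;
`Z` collects the vertices missed on either side. -/
theorem IsMatchingOff.swapOn {X Y Z : Finset α} {P Q : Finset (Sym2 α)} {C : Set α}
    (hP : IsMatchingOff G X P) (hQ : IsMatchingOff G Y Q) (hPC : EdgeClosed P C)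
    (hQC : EdgeClosed Q C) (hZ : ∀ v, v ∈ Z ↔ (v ∈ X ∧ v ∉ C) ∨ (v ∈ Y ∧ v ∈ C)) :
    IsMatchingOff G Z (swapOn C P Q) := by
  refine ⟨fun e he ↦ ?_, fun e he v hv hvZ ↦ ?_, fun e he f hf v hve hvf ↦ ?_, fun v hv ↦ ?_⟩
  · rcases mem_swapOn.1 he with h | h
    exacts [hP.mem_edgeSet e h.1, hQ.mem_edgeSet e h.1]
  · rcases mem_swapOn.1 he with ⟨h, hC⟩ | ⟨h, u, hu, hC⟩
    · rcases (hZ v).1 hvZ with hvX | hvY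
      exacts [hP.notMem e h v hv hvX.1, hC ⟨v, hv, hvY.2⟩]
    · rcases (hZ v).1 hvZ with hvX | hvY
      exacts [hvX.2 (hQC e h u hu v hv hC), hQ.notMem e h v hv hvY.1]
  · rcases mem_swapOn.1 he with ⟨h, hC⟩ | ⟨h, u, hu, hC⟩ <;>
      rcases mem_swapOn.1 hf with ⟨h', hC'⟩ | ⟨h', u', hu', hC'⟩
    · exact hP.eq_of_mem e h f h' v hve hvf
    · exact absurd ⟨v, hve, hQC f h' u' hu' v hvf hC'⟩ hC
    · exact absurd ⟨v, hvf, hQC e h u hu v hve hC⟩ hC'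
    · exact hQ.eq_of_mem e h f h' v hve hvf
  · by_cases hvC : v ∈ C
    · obtain ⟨e, he, hve⟩ := hQ.covers v fun h ↦ hv ((hZ v).2 (Or.inr ⟨h, hvC⟩))
      exact ⟨e, mem_swapOn.2 (Or.inr ⟨he, v, hve, hvC⟩), hve⟩
    · obtain ⟨e, he, hve⟩ := hP.covers v fun h ↦ hv ((hZ v).2 (Or.inl ⟨h, hvC⟩))
      exact ⟨e, mem_swapOn.2 (Or.inl ⟨he, fun ⟨u, hu, huC⟩ ↦ hvC (hPC e he u hu v hve huC)⟩), hve⟩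

/-- The graph whose edges are those of `P` and `Q`. -/
def unionGraph (P Q : Finset (Sym2 α)) : SimpleGraph α :=
  SimpleGraph.fromEdgeSet (↑(P ∪ Q) : Set (Sym2 α))

theorem unionGraph_adj {P Q : Finset (Sym2 α)} {u v : α} :
    (unionGraph P Q).Adj u v ↔ s(u, v) ∈ P ∪ Q ∧ u ≠ v := by
  rw [unionGraph, SimpleGraph.fromEdgeSet_adj, Finset.mem_coe]

/-- The vertex set of the component of `a` in the union of `P` and `Q`. -/
def comp (P Q : Finset (Sym2 α)) (a : α) : Set α := {v | (unionGraph P Q).Reachable a v}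

theorem edgeClosed_comp {P Q P' : Finset (Sym2 α)} (a : α) (h : P' ⊆ P ∪ Q) :
    EdgeClosed P' (comp P Q a) := by
  intro e he u hu v hv hC
  by_cases huv : u = v
  · exact huv ▸ hC
  · refine SimpleGraph.Reachable.trans hC (SimpleGraph.Adj.reachable ?_)
    have := (Sym2.mem_and_mem_iff huv).1 ⟨hu, hv⟩
    exact unionGraph_adj.2 ⟨this ▸ h he, huv⟩

/-- The exchange keeps the union of the two edge sets, hence the component. This is what makes
`swapPair` an involution. -/
theorem comp_swapOn (C : Set α) (P Q : Finset (Sym2 α)) (a : α) :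
    comp (swapOn C P Q) (swapOn C Q P) a = comp P Q a := by
  simp only [comp, unionGraph, swapOn_union_swapOn]

theorem unionGraph_le {X Y : Finset α} {P Q : Finset (Sym2 α)} (hP : IsMatchingOff G X P)
    (hQ : IsMatchingOff G Y Q) : unionGraph P Q ≤ G := by
  intro u v huv
  rcases Finset.mem_union.1 (unionGraph_adj.1 huv).1 with h | h
  exacts [hP.mem_edgeSet _ h, hQ.mem_edgeSet _ h]

/-- Exchange the two matchings inside the component of `a`. -/
noncomputable def swapPair (a : α) (p : Finset (Sym2 α) × Finset (Sym2 α)) :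
    Finset (Sym2 α) × Finset (Sym2 α) :=
  (swapOn (comp p.1 p.2 a) p.1 p.2, swapOn (comp p.1 p.2 a) p.2 p.1)

theorem swapPair_swapPair (a : α) (p : Finset (Sym2 α) × Finset (Sym2 α)) :
    swapPair a (swapPair a p) = p := by
  simp only [swapPair, comp_swapOn, swapOn_swapOn]

variable [Fintype α]

/-- The edges of `P` that meet `C` partition `C \ X`. The choice `f = 1` counts vertices, and a
choice of colour signs gives the balance of colours. -/
theorem IsMatchingOff.sum_eq {M : Type*} [AddCommMonoid M] {X : Finset α} {P : Finset (Sym2 α)}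
    {C : Set α} (hP : IsMatchingOff G X P) (hC : EdgeClosed P C) (f : α → M) :
    ∑ v with v ∈ C ∧ v ∉ X, f v = ∑ e ∈ P with Meets C e, ∑ v ∈ e.toFinset, f v := by
  rw [← Finset.sum_biUnion]
  · refine Finset.sum_congr ?_ fun _ _ ↦ rfl
    ext v
    simp only [Finset.mem_filter, Finset.mem_univ, true_and, Finset.mem_biUnion, Sym2.mem_toFinset]
    constructor
    · rintro ⟨hvC, hvX⟩
      obtain ⟨e, he, hve⟩ := hP.covers v hvX
      exact ⟨e, ⟨he, v, hve, hvC⟩, hve⟩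
    · rintro ⟨e, ⟨he, u, hu, huC⟩, hv⟩
      exact ⟨hC e he u hu v hv huC, hP.notMem e he v hv⟩
  · intro e he f hf hne
    simp only [Finset.coe_filter, Set.mem_ofPred_eq] at he hf
    rw [Function.onFun, Finset.disjoint_left]
    intro v hve hvf
    exact hne (hP.eq_of_mem e he.1 f hf.1 v (by simpa using hve) (by simpa using hvf))

theorem IsMatchingOff.card_eq {X : Finset α} {P : Finset (Sym2 α)} {C : Set α}
    (hP : IsMatchingOff G X P) (hC : EdgeClosed P C) :
    Finset.card {v | v ∈ C ∧ v ∉ X} = 2 * Finset.card {e ∈ P | Meets C e} := by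
  have h := hP.sum_eq hC fun _ ↦ 1
  rw [Finset.card_eq_sum_ones, h, mul_comm, ← smul_eq_mul, ← Finset.sum_const]
  refine Finset.sum_congr rfl fun e he ↦ ?_
  rw [← Finset.card_eq_sum_ones, Sym2.card_toFinset_of_not_isDiag]
  exact G.not_isDiag_of_mem_edgeSet (hP.mem_edgeSet e (Finset.mem_filter.1 he).1)

theorem IsMatchingOff.sum_eq_zero {X : Finset α} {P : Finset (Sym2 α)} {C : Set α}
    (hP : IsMatchingOff G X P) (hC : EdgeClosed P C) {δ : α → ℤ}
    (hδ : ∀ u v, G.Adj u v → δ u + δ v = 0) : ∑ v with v ∈ C ∧ v ∉ X, δ v = 0 := by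
  rw [hP.sum_eq hC]
  refine Finset.sum_eq_zero fun e he ↦ ?_
  have := hP.mem_edgeSet e (Finset.mem_filter.1 he).1
  induction e with
  | _ u v =>
    rw [Sym2.toFinset_mk_eq, Finset.sum_pair (SimpleGraph.Adj.ne this)]
    exact hδ u v this

/-- A connected graph has at most one vertex more than it has edges. An edge in both `P` and `Q` is
counted twice, which only weakens the bound. -/
theorem card_comp_le (P Q : Finset (Sym2 α)) (a : α) :
    Finset.card {v | v ∈ comp P Q a} ≤ Finset.card {e ∈ P | Meets (comp P Q a) e} +
      Finset.card {e ∈ Q | Meets (comp P Q a) e} + 1 := by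
  let c := (unionGraph P Q).connectedComponentMk a
  have h := c.connected_toSimpleGraph.card_vert_le_card_edgeSet_add_one
  have hmem : ∀ v, v ∈ c.supp ↔ v ∈ comp P Q a := fun v ↦ by
    simp [c, comp, SimpleGraph.reachable_comm]
  have h1 : Nat.card c = Finset.card {v | v ∈ comp P Q a} := by
    change Nat.card c.supp = _
    rw [Nat.card_eq_fintype_card, Fintype.card_subtype]
    simp only [hmem]
  have h2 : Nat.card c.toSimpleGraph.edgeSet ≤
      Finset.card ({e ∈ P | Meets (comp P Q a) e} ∪ {e ∈ Q | Meets (comp P Q a) e}) := by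
    rw [← Fintype.card_coe, ← Nat.card_eq_fintype_card]
    have hmaps : ∀ e ∈ c.toSimpleGraph.edgeSet, Sym2.map Subtype.val e ∈
        ({e ∈ P | Meets (comp P Q a) e} ∪ {e ∈ Q | Meets (comp P Q a) e} : Finset _) := by
      intro e he
      induction e with
      | _ u v =>
        have hadj : (unionGraph P Q).Adj u v := he
        have hm : Meets (comp P Q a) s(u.1, v.1) := ⟨u, by simp, (hmem u).1 u.2⟩
        have := (unionGraph_adj.1 hadj).1
        simp only [Finset.mem_union, Finset.mem_filter, Sym2.map_mk] at this ⊢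
        tauto
    refine Nat.card_le_card_of_injective (fun e ↦ ⟨Sym2.map Subtype.val e.1, hmaps e.1 e.2⟩) ?_
    intro e f hef
    exact Subtype.ext (Sym2.map.injective Subtype.val_injective (congrArg Subtype.val hef))
  have h3 := Finset.card_union_le {e ∈ P | Meets (comp P Q a) e} {e ∈ Q | Meets (comp P Q a) e}
  omega

end Matchings

/-! ### Pairs of matchings sorted by the component of `a` -/

section Condensation

open scoped Classical symmDiff

variable {α : Type*} {G : SimpleGraph α} [Fintype α]

/-- Let the component `C` meet `p` edges of `P` and `q` edges of `Q`. Then `|C| = |X ∩ C| + 2p = |Y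
∩ C| + 2q`, while `|C| ≤ p + q + 1`; adding the two equations bounds `|X ∩ C| + |Y ∩ C|` by 2. -/
theorem card_filter_comp_le {X Y : Finset α} {P Q : Finset (Sym2 α)} (hP : IsMatchingOff G X P)
    (hQ : IsMatchingOff G Y Q) (hXY : Disjoint X Y) (a : α) :
    Finset.card {v ∈ X ∪ Y | v ∈ comp P Q a} ≤ 2 := by
  have h := card_comp_le P Q a
  have h1 := hP.card_eq (edgeClosed_comp (Q := Q) a Finset.subset_union_left)
  have h2 := hQ.card_eq (edgeClosed_comp (P := P) a Finset.subset_union_right)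
  have split : ∀ Z : Finset α, Finset.card {v | v ∈ comp P Q a} =
      Finset.card {v ∈ Z | v ∈ comp P Q a} + Finset.card {v | v ∈ comp P Q a ∧ v ∉ Z} := by
    intro Z
    rw [← Finset.card_filter_add_card_filter_not (· ∈ Z), Finset.filter_filter,
      Finset.filter_filter]
    congr 2
    ext v
    simp [and_comm]
  have h3 := split X
  have h4 := split Y
  rw [Finset.filter_union, Finset.card_union_of_disjoint (Finset.disjoint_filter_filter hXY)]
  omega

/-- The colour of a vertex that `P` or `Q` misses, with a sign that says which of them. -/
noncomputable def signedColour (X : Finset α) (δ : α → ℤ) (v : α) : ℤ := if v ∈ X then δ v else -δ v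

/-- Both `C \ X` and `C \ Y` are balanced in colour, so `X ∩ C` and `Y ∩ C` have the same colour
sum, namely that of `C`. -/
theorem sum_signedColour_eq_zero {X Y : Finset α} {P Q : Finset (Sym2 α)}
    (hP : IsMatchingOff G X P) (hQ : IsMatchingOff G Y Q) (hXY : Disjoint X Y) {δ : α → ℤ}
    (hδ : ∀ u v, G.Adj u v → δ u + δ v = 0) (a : α) :
    ∑ v ∈ X ∪ Y with v ∈ comp P Q a, signedColour X δ v = 0 := by
  have h1 := hP.sum_eq_zero (edgeClosed_comp (Q := Q) a Finset.subset_union_left) hδ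
  have h2 := hQ.sum_eq_zero (edgeClosed_comp (P := P) a Finset.subset_union_right) hδ
  have split : ∀ Z : Finset α, ∑ v with v ∈ comp P Q a, δ v =
      ∑ v ∈ Z with v ∈ comp P Q a, δ v + ∑ v with v ∈ comp P Q a ∧ v ∉ Z, δ v := by
    intro Z
    rw [← Finset.sum_filter_add_sum_filter_not _ (· ∈ Z), Finset.filter_filter,
      Finset.filter_filter]
    congr 2
    ext v
    simp [and_comm]
  have h3 := split X
  have h4 := split Y
  rw [Finset.filter_union, Finset.sum_union (Finset.disjoint_filter_filter hXY)]
  have h5 : ∑ v ∈ X with v ∈ comp P Q a, signedColour X δ v =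
      ∑ v ∈ X with v ∈ comp P Q a, δ v :=
    Finset.sum_congr rfl fun v hv ↦ if_pos (Finset.mem_filter.1 hv).1
  have h6 : ∑ v ∈ Y with v ∈ comp P Q a, signedColour X δ v =
      -∑ v ∈ Y with v ∈ comp P Q a, δ v := by
    rw [← Finset.sum_neg_distrib]
    exact Finset.sum_congr rfl fun v hv ↦
      if_neg (Finset.disjoint_right.1 hXY (Finset.mem_filter.1 hv).1)
  rw [h5, h6]
  linarith

/-- A component contains none or two of the vertices that are missed by `P` or `Q`. -/
theorem exists_filter_comp_eq_pair {X Y : Finset α} {P Q : Finset (Sym2 α)}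
    (hP : IsMatchingOff G X P) (hQ : IsMatchingOff G Y Q) (hXY : Disjoint X Y) {δ : α → ℤ}
    (hδ : ∀ u v, G.Adj u v → δ u + δ v = 0) (hδ0 : ∀ v, δ v ≠ 0) {a : α} (ha : a ∈ X ∪ Y) :
    ∃ x ∈ X ∪ Y, x ≠ a ∧ ({v ∈ X ∪ Y | v ∈ comp P Q a} : Finset α) = {a, x} := by
  have haS : a ∈ ({v ∈ X ∪ Y | v ∈ comp P Q a} : Finset α) :=
    Finset.mem_filter.2 ⟨ha, SimpleGraph.Reachable.refl a⟩
  have h1 := card_filter_comp_le hP hQ hXY a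
  have h2 := sum_signedColour_eq_zero hP hQ hXY hδ a
  -- If `a` were the only such vertex, the signed colour sum would be `±δ a`, which is not zero.
  have h3 : ∃ x ∈ ({v ∈ X ∪ Y | v ∈ comp P Q a} : Finset α), x ≠ a := by
    by_contra! h
    rw [Finset.eq_singleton_iff_unique_mem.2 ⟨haS, h⟩, Finset.sum_singleton, signedColour] at h2
    split_ifs at h2
    exacts [hδ0 a h2, hδ0 a (neg_eq_zero.1 h2)]
  obtain ⟨x, hx, hxa⟩ := h3
  refine ⟨x, (Finset.mem_filter.1 hx).1, hxa, (Finset.eq_of_subset_of_card_le ?_ ?_).symm⟩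
  · exact Finset.insert_subset haS (Finset.singleton_subset_iff.2 hx)
  · rwa [Finset.card_pair hxa.symm]

/-- The two vertices in the component of `a` are not opposite to each other if walks that join
opposite vertices intersect. -/
theorem filter_comp_eq_or {X Y : Finset α} {P Q : Finset (Sym2 α)}
    (hP : IsMatchingOff G X P) (hQ : IsMatchingOff G Y Q) (hXY : Disjoint X Y) {δ : α → ℤ}
    (hδ : ∀ u v, G.Adj u v → δ u + δ v = 0) (hδ0 : ∀ v, δ v ≠ 0) {a b c d : α}
    (hT : X ∪ Y = {a, b, c, d}) (hba : b ≠ a) (hbc : b ≠ c)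
    (hcross : ∀ (p : G.Walk a c) (q : G.Walk b d), ∃ v ∈ p.support, v ∈ q.support) :
    ({v ∈ X ∪ Y | v ∈ comp P Q a} : Finset α) = {a, b} ∨
      ({v ∈ X ∪ Y | v ∈ comp P Q a} : Finset α) = {a, d} := by
  obtain ⟨x, hx, hxa, hS⟩ := exists_filter_comp_eq_pair hP hQ hXY hδ hδ0 (a := a) (by simp [hT])
  rw [hS]
  simp only [hT, Finset.mem_insert, Finset.mem_singleton] at hx
  rcases hx with rfl | rfl | rfl | rfl
  · exact absurd rfl hxa
  · exact Or.inl rfl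
  · exfalso
    -- With `a` and `c` in one component, the partner of `b` can only be `d`. The two walks then
    -- cross, which merges the components although `b` is not in that of `a`.
    obtain ⟨y, hy, hyb, hS'⟩ :=
      exists_filter_comp_eq_pair hP hQ hXY hδ hδ0 (a := b) (by simp [hT])
    have hxC : (unionGraph P Q).Reachable a x :=
      (Finset.mem_filter.1 (hS ▸ by simp : x ∈ ({v ∈ X ∪ Y | v ∈ comp P Q a} : Finset α))).2
    have hyC : (unionGraph P Q).Reachable b y :=
      (Finset.mem_filter.1 (hS' ▸ by simp : y ∈ ({v ∈ X ∪ Y | v ∈ comp P Q b} : Finset α))).2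
    have hbC : ¬ (unionGraph P Q).Reachable a b := fun h ↦ by
      have : b ∈ ({v ∈ X ∪ Y | v ∈ comp P Q a} : Finset α) :=
        Finset.mem_filter.2 ⟨by simp [hT], h⟩
      rw [hS] at this
      simp [hba, hbc] at this
    have hyd : y = d := by
      simp only [hT, Finset.mem_insert, Finset.mem_singleton] at hy
      rcases hy with rfl | rfl | rfl | rfl
      · exact absurd hyC.symm hbC
      · exact absurd rfl hyb
      · exact absurd (hxC.trans hyC.symm) hbC
      · rfl
    subst hyd
    obtain ⟨p⟩ := hxC
    obtain ⟨q⟩ := hyC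
    obtain ⟨v, hvp, hvq⟩ := hcross (p.mapLe (unionGraph_le hP hQ)) (q.mapLe (unionGraph_le hP hQ))
    rw [SimpleGraph.Walk.support_mapLe_eq_support] at hvp hvq
    exact hbC ((p.takeUntil v hvp).reachable.trans (q.takeUntil v hvq).reachable.symm)
  · exact Or.inr rfl

/-- The perfect matchings of `G - X`. -/
noncomputable def matchingsOff (G : SimpleGraph α) (X : Finset α) : Finset (Finset (Sym2 α)) :=
  {P | IsMatchingOff G X P}

theorem mem_matchingsOff {X : Finset α} {P : Finset (Sym2 α)} :
    P ∈ matchingsOff G X ↔ IsMatchingOff G X P := by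
  simp [matchingsOff]

variable {R : Type*} [CommRing R] (w : Sym2 α → R)

theorem matchingSum_deleteVerts (X : Finset α) :
    matchingSum w ((⊤ : G.Subgraph).deleteVerts X) = ∑ P ∈ matchingsOff G X, ∏ e ∈ P, w e := by
  simp only [matchingSum, matchingsOff, isPerfectMatchingSet_deleteVerts_iff]

/-- The pairs of perfect matchings of `G - X` and of `G - Y` in whose union `S` is the set of
those vertices of `X ∪ Y` that lie in the component of `a`. -/
noncomputable def matchingPairs (G : SimpleGraph α) (a : α) (S X Y : Finset α) :
    Finset (Finset (Sym2 α) × Finset (Sym2 α)) :=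
  {p ∈ matchingsOff G X ×ˢ matchingsOff G Y | {v ∈ X ∪ Y | v ∈ comp p.1 p.2 a} = S}

theorem mem_matchingPairs {a : α} {S X Y : Finset α} {p : Finset (Sym2 α) × Finset (Sym2 α)} :
    p ∈ matchingPairs G a S X Y ↔ (IsMatchingOff G X p.1 ∧ IsMatchingOff G Y p.2) ∧
      ({v ∈ X ∪ Y | v ∈ comp p.1 p.2 a} : Finset α) = S := by
  simp [matchingPairs, mem_matchingsOff]

/-- The weights of the pairs in `matchingPairs G a S X Y`, added up. -/
noncomputable def pairSum (G : SimpleGraph α) (a : α) (S X Y : Finset α) : R :=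
  ∑ p ∈ matchingPairs G a S X Y, (∏ e ∈ p.1, w e) * ∏ e ∈ p.2, w e

theorem swapPair_mem {a : α} {S X Y X' Y' : Finset α} (hXY : Disjoint X Y)
    (hX' : X' = X ∆ S) (hY' : Y' = Y ∆ S) {p : Finset (Sym2 α) × Finset (Sym2 α)}
    (hp : p ∈ matchingPairs G a S X Y) : swapPair a p ∈ matchingPairs G a S X' Y' := by
  obtain ⟨⟨hP, hQ⟩, hS⟩ := mem_matchingPairs.1 hp
  have hmem : ∀ v, v ∈ S ↔ (v ∈ X ∨ v ∈ Y) ∧ v ∈ comp p.1 p.2 a := fun v ↦ by simp [← hS]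
  have hd : ∀ v, v ∈ X → v ∉ Y := fun v hv ↦ Finset.disjoint_left.1 hXY hv
  have hPC := edgeClosed_comp (P := p.1) (Q := p.2) a Finset.subset_union_left
  have hQC := edgeClosed_comp (P := p.1) (Q := p.2) a Finset.subset_union_right
  have hX : ∀ v, v ∈ X' ↔ (v ∈ X ∧ v ∉ comp p.1 p.2 a) ∨ (v ∈ Y ∧ v ∈ comp p.1 p.2 a) := by
    intro v
    rw [hX', Finset.mem_symmDiff, hmem]
    have := hd v
    tauto
  have hY : ∀ v, v ∈ Y' ↔ (v ∈ Y ∧ v ∉ comp p.1 p.2 a) ∨ (v ∈ X ∧ v ∈ comp p.1 p.2 a) := by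
    intro v
    rw [hY', Finset.mem_symmDiff, hmem]
    have := hd v
    tauto
  refine mem_matchingPairs.2 ⟨⟨hP.swapOn hQ hPC hQC hX, hQ.swapOn hP hQC hPC hY⟩, ?_⟩
  ext v
  simp only [swapPair, comp_swapOn, Finset.mem_filter, Finset.mem_union, hX, hY, hmem]
  tauto

/-- `swapPair` is a weight-preserving bijection; its inverse is the same map, because taking the
symmetric difference with `S` twice gives back `X` and `Y`. -/
theorem pairSum_symmDiff {a : α} {S X Y X' Y' : Finset α} (hXY : Disjoint X Y)
    (hXY' : Disjoint X' Y') (hX' : X' = X ∆ S) (hY' : Y' = Y ∆ S) :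
    pairSum w G a S X Y = pairSum w G a S X' Y' := by
  refine Finset.sum_nbij' (swapPair a) (swapPair a)
    (fun p hp ↦ swapPair_mem hXY hX' hY' hp)
    (fun p hp ↦ swapPair_mem hXY' (by rw [hX', symmDiff_symmDiff_cancel_right])
      (by rw [hY', symmDiff_symmDiff_cancel_right]) hp)
    (fun p _ ↦ swapPair_swapPair a p) (fun p _ ↦ swapPair_swapPair a p) fun p _ ↦ ?_
  exact (prod_swapOn_mul_prod_swapOn w _ _ _).symm

/-- Two vertices of one component must have opposite colours if the same matching misses both, and
equal colours otherwise. Types that violate this are empty. -/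
theorem pairSum_eq_zero {X Y : Finset α} (hXY : Disjoint X Y) {δ : α → ℤ}
    (hδ : ∀ u v, G.Adj u v → δ u + δ v = 0) {a x : α} (hxa : a ≠ x)
    (h : signedColour X δ a + signedColour X δ x ≠ 0) : pairSum w G a {a, x} X Y = 0 := by
  refine Finset.sum_eq_zero fun p hp ↦ absurd ?_ h
  obtain ⟨⟨hP, hQ⟩, hS⟩ := mem_matchingPairs.1 hp
  rw [← Finset.sum_pair hxa, ← hS]
  exact sum_signedColour_eq_zero hP hQ hXY hδ a

theorem matchingSum_mul_matchingSum {X Y : Finset α} (hXY : Disjoint X Y) {δ : α → ℤ}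
    (hδ : ∀ u v, G.Adj u v → δ u + δ v = 0) (hδ0 : ∀ v, δ v ≠ 0) {a b c d : α}
    (hT : X ∪ Y = {a, b, c, d}) (hba : b ≠ a) (hbc : b ≠ c) (hbd : b ≠ d)
    (hcross : ∀ (p : G.Walk a c) (q : G.Walk b d), ∃ v ∈ p.support, v ∈ q.support) :
    matchingSum w ((⊤ : G.Subgraph).deleteVerts X) *
        matchingSum w ((⊤ : G.Subgraph).deleteVerts Y) =
      pairSum w G a {a, b} X Y + pairSum w G a {a, d} X Y := by
  rw [matchingSum_deleteVerts, matchingSum_deleteVerts, Finset.sum_mul_sum,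
    ← Finset.sum_product', pairSum, pairSum, matchingPairs, matchingPairs,
    ← Finset.sum_filter_add_sum_filter_not _
      (fun p ↦ ({v ∈ X ∪ Y | v ∈ comp p.1 p.2 a} : Finset α) = {a, b})]
  congr 2
  refine Finset.filter_congr fun p hp ↦ ?_
  obtain ⟨hP, hQ⟩ := Finset.mem_product.1 hp
  have hne : ({a, b} : Finset α) ≠ {a, d} := fun h ↦ by
    have : b ∈ ({a, d} : Finset α) := h ▸ by simp
    simp [hba, hbd] at this
  rcases filter_comp_eq_or (mem_matchingsOff.1 hP) (mem_matchingsOff.1 hQ) hXY hδ hδ0 hT hba hbc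
    hcross with h | h
  · simp [h, hne]
  · simp [h, hne.symm]

end Condensation

/-! ### Expansion of the matching sum along an edge -/

section EdgeExpansion

open scoped Classical

variable {α : Type*} {G : SimpleGraph α}

theorem mem_edgeSet_deleteEdges {H : G.Subgraph} {e f : Sym2 α} :
    f ∈ (H.deleteEdges {e}).edgeSet ↔ f ∈ H.edgeSet ∧ f ≠ e := by
  induction f with
  | _ u v => simp

theorem isPerfectMatchingSet_deleteEdges_iff {H : G.Subgraph} {P : Finset (Sym2 α)} {e : Sym2 α} :
    IsPerfectMatchingSet (H.deleteEdges {e}) P ↔ IsPerfectMatchingSet H P ∧ e ∉ P := by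
  constructor
  · rintro ⟨h1, h2, h3⟩
    exact ⟨⟨fun f hf ↦ (mem_edgeSet_deleteEdges.1 (h1 f hf)).1, h2, h3⟩,
      fun he ↦ (mem_edgeSet_deleteEdges.1 (h1 e he)).2 rfl⟩
  · rintro ⟨⟨h1, h2, h3⟩, he⟩
    exact ⟨fun f hf ↦ mem_edgeSet_deleteEdges.2 ⟨h1 f hf, fun h ↦ he (h ▸ hf)⟩, h2, h3⟩

theorem mem_edgeSet_deleteVerts_pair {H : G.Subgraph} {a b : α} {e : Sym2 α} :
    e ∈ (H.deleteVerts {a, b}).edgeSet ↔ e ∈ H.edgeSet ∧ a ∉ e ∧ b ∉ e := by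
  induction e with
  | _ u v =>
    simp only [SimpleGraph.Subgraph.mem_edgeSet, SimpleGraph.Subgraph.deleteVerts_adj,
      Set.mem_insert_iff, Set.mem_singleton_iff, Sym2.mem_iff]
    constructor
    · rintro ⟨-, hu, -, hv, h⟩
      exact ⟨h, by tauto, by tauto⟩
    · rintro ⟨h, h1, h2⟩
      exact ⟨h.fst_mem, by tauto, h.snd_mem, by tauto, h⟩

theorem IsPerfectMatchingSet.erase {H : G.Subgraph} {a b : α} {P : Finset (Sym2 α)}
    (hP : IsPerfectMatchingSet H P) (h : s(a, b) ∈ P) :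
    IsPerfectMatchingSet (H.deleteVerts {a, b}) (P.erase s(a, b)) := by
  obtain ⟨h1, h2, h3⟩ := hP
  refine ⟨fun f hf ↦ ?_, fun e he f hf ↦
    h2 e (Finset.mem_of_mem_erase he) f (Finset.mem_of_mem_erase hf), fun v hv ↦ ?_⟩
  · obtain ⟨hne, hf⟩ := Finset.mem_erase.1 hf
    exact mem_edgeSet_deleteVerts_pair.2 ⟨h1 f hf, h2 _ h f hf hne.symm a (by simp),
      h2 _ h f hf hne.symm b (by simp)⟩
  · simp only [SimpleGraph.Subgraph.deleteVerts_verts, Set.mem_sdiff, Set.mem_insert_iff,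
      Set.mem_singleton_iff] at hv
    obtain ⟨f, hf, hvf⟩ := h3 v hv.1
    refine ⟨f, Finset.mem_erase.2 ⟨?_, hf⟩, hvf⟩
    rintro rfl
    exact hv.2 (Sym2.mem_iff.1 hvf)

theorem IsPerfectMatchingSet.notMem {H : G.Subgraph} {a b : α} {P : Finset (Sym2 α)}
    (hP : IsPerfectMatchingSet (H.deleteVerts {a, b}) P) : s(a, b) ∉ P := fun h ↦
  (mem_edgeSet_deleteVerts_pair.1 (hP.subset_edgeSet _ h)).2.1 (by simp)

theorem IsPerfectMatchingSet.insert {H : G.Subgraph} {a b : α} {P : Finset (Sym2 α)}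
    (hab : H.Adj a b) (hP : IsPerfectMatchingSet (H.deleteVerts {a, b}) P) :
    IsPerfectMatchingSet H (insert s(a, b) P) := by
  obtain ⟨h1, h2, h3⟩ := hP
  have key : ∀ f ∈ P, ∀ v, v ∈ s(a, b) → v ∉ f := by
    intro f hf v hv
    have := mem_edgeSet_deleteVerts_pair.1 (h1 f hf)
    rcases Sym2.mem_iff.1 hv with rfl | rfl
    exacts [this.2.1, this.2.2]
  refine ⟨fun f hf ↦ ?_, fun e he f hf hne v hve hvf ↦ ?_, fun v hv ↦ ?_⟩
  · rcases Finset.mem_insert.1 hf with rfl | hf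
    exacts [hab, (mem_edgeSet_deleteVerts_pair.1 (h1 f hf)).1]
  · rcases Finset.mem_insert.1 he with rfl | he <;> rcases Finset.mem_insert.1 hf with rfl | hf
    exacts [hne rfl, key f hf v hve hvf, key e he v hvf hve, h2 e he f hf hne v hve hvf]
  · by_cases hvab : v ∈ s(a, b)
    · exact ⟨_, Finset.mem_insert_self _ _, hvab⟩
    · obtain ⟨f, hf, hvf⟩ := h3 v ⟨hv, by simpa [Sym2.mem_iff] using hvab⟩
      exact ⟨f, Finset.mem_insert_of_mem hf, hvf⟩

/-- Perfect matchings that avoid an edge and perfect matchings that contain it. -/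
theorem matchingSum_eq_add [Fintype α] {R : Type*} [CommRing R] (w : Sym2 α → R) {H : G.Subgraph}
    {a b : α} (hab : H.Adj a b) : matchingSum w H =
      matchingSum w (H.deleteEdges {s(a, b)}) +
        w s(a, b) * matchingSum w (H.deleteVerts {a, b}) := by
  rw [matchingSum, ← Finset.sum_filter_add_sum_filter_not _ (fun P ↦ s(a, b) ∉ P)]
  congr 1
  · rw [matchingSum, Finset.filter_filter]
    simp only [isPerfectMatchingSet_deleteEdges_iff]
  · rw [matchingSum, Finset.mul_sum, Finset.filter_filter]
    simp only [not_not]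
    refine Finset.sum_nbij' (fun P ↦ P.erase s(a, b)) (fun P ↦ insert s(a, b) P) ?_ ?_ ?_ ?_ ?_
    · intro P hP
      simp only [Finset.mem_filter, Finset.mem_univ, true_and] at hP ⊢
      exact hP.1.erase hP.2
    · intro P hP
      simp only [Finset.mem_filter, Finset.mem_univ, true_and] at hP ⊢
      exact ⟨hP.insert hab, Finset.mem_insert_self _ _⟩
    · intro P hP
      exact Finset.insert_erase (Finset.mem_filter.1 hP).2.2
    · intro P hP
      exact Finset.erase_insert (Finset.mem_filter.1 hP).2.notMem
    · intro P hP
      exact (Finset.mul_prod_erase _ _ (Finset.mem_filter.1 hP).2.2).symm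

/-- The colours of a bipartite graph as signs. -/
theorem exists_sign_of_isBipartiteWith {U V : Set α} (hG : G.IsBipartiteWith U V) :
    ∃ δ : α → ℤ, (∀ u v, G.Adj u v → δ u + δ v = 0) ∧ (∀ v, δ v ≠ 0) ∧
      (∀ v ∈ U, δ v = 1) ∧ ∀ v ∈ V, δ v = -1 := by
  have hV : ∀ v ∈ V, v ∉ U := fun v hv hu ↦ Set.disjoint_left.1 hG.disjoint hu hv
  refine ⟨fun v ↦ if v ∈ U then 1 else -1, fun u v h ↦ ?_, fun v ↦ ?_, fun v hv ↦ if_pos hv,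
    fun v hv ↦ if_neg (hV v hv)⟩
  · rcases hG.mem_of_adj h with ⟨h1, h2⟩ | ⟨h1, h2⟩
    · simp [h1, hV _ h2]
    · simp [h2, hV _ h1]
  · dsimp only
    split_ifs <;> simp

end EdgeExpansion

/-! ### The two condensation identities -/

section Kuo

open scoped Classical symmDiff

variable {α : Type*} {G : SimpleGraph α} [Fintype α] {R : Type*} [CommRing R] (w : Sym2 α → R)

/-- Kuo condensation for two adjacent pairs of vertices of the same colour. -/
theorem matchingSum_condensation_adjacent {δ : α → ℤ} (hδ : ∀ u v, G.Adj u v → δ u + δ v = 0)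
    (hδ0 : ∀ v, δ v ≠ 0) {a b c d : α} (hab : a ≠ b) (hac : a ≠ c) (had : a ≠ d) (hbc : b ≠ c)
    (hbd : b ≠ d) (hcd : c ≠ d)
    (hcross : ∀ (p : G.Walk a c) (q : G.Walk b d), ∃ v ∈ p.support, v ∈ q.support)
    (hb : δ b = -δ a) (hd : δ d = δ a) :
    matchingSum w ((⊤ : G.Subgraph).deleteVerts {c, d}) *
        matchingSum w ((⊤ : G.Subgraph).deleteVerts {a, b}) =
      matchingSum w ((⊤ : G.Subgraph).deleteVerts {a, b, c, d}) * matchingSum w (⊤ : G.Subgraph) +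
      matchingSum w ((⊤ : G.Subgraph).deleteVerts {a, c}) *
        matchingSum w ((⊤ : G.Subgraph).deleteVerts {b, d}) := by
  have main : ∀ X Y : Finset α, Disjoint X Y → X ∪ Y = {a, b, c, d} → _ := fun X Y hXY hT ↦
    matchingSum_mul_matchingSum w hXY hδ hδ0 hT hab.symm hbc hbd hcross
  have d1 : Disjoint ({c, d} : Finset α) {a, b} := by simp [*]
  have d2 : Disjoint ({a, c} : Finset α) {b, d} := by simp [*, ne_comm]
  have d3 : Disjoint ({a, b, c, d} : Finset α) ∅ := by simp
  have e1 := main {c, d} {a, b} d1 (by ext; simp; tauto)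
  have e2 := main {a, b, c, d} ∅ d3 (by simp)
  have e3 := main {a, c} {b, d} d2 (by ext; simp; tauto)
  have ha0 := hδ0 a
  -- Of the six types, two are impossible: `a, d` of equal colour missed by one matching, and `a, b`
  -- of different colours missed by different matchings. The exchange pairs up the other four.
  have z2 := pairSum_eq_zero w d3 hδ had (by simp [signedColour, hd, ha0])
  have z3 := pairSum_eq_zero w d2 hδ hab (by simp [signedColour, hb, hab.symm, hbc, ha0])
  have s1 := pairSum_symmDiff (G := G) w (a := a) (S := {a, b}) d1 d3
    (by ext; grind [Finset.mem_symmDiff]) (by ext; grind [Finset.mem_symmDiff])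
  have s2 := pairSum_symmDiff (G := G) w (a := a) (S := {a, d}) d1 d2
    (by ext; grind [Finset.mem_symmDiff]) (by ext; grind [Finset.mem_symmDiff])
  push_cast at e1 e2 e3
  rw [SimpleGraph.Subgraph.deleteVerts_empty] at e2
  rw [e1, e2, e3, z2, z3, s1, s2]
  ring

/-- Kuo condensation for vertices of alternating colours. -/
theorem matchingSum_condensation_alternating {δ : α → ℤ}
    (hδ : ∀ u v, G.Adj u v → δ u + δ v = 0)
    (hδ0 : ∀ v, δ v ≠ 0) {a b c d : α} (hab : a ≠ b) (hac : a ≠ c) (had : a ≠ d) (hbc : b ≠ c)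
    (hbd : b ≠ d) (hcd : c ≠ d)
    (hcross : ∀ (p : G.Walk a c) (q : G.Walk b d), ∃ v ∈ p.support, v ∈ q.support)
    (hb : δ b = -δ a) (hd : δ d = -δ a) :
    matchingSum w ((⊤ : G.Subgraph).deleteVerts {a, b, c, d}) * matchingSum w (⊤ : G.Subgraph) =
      matchingSum w ((⊤ : G.Subgraph).deleteVerts {c, d}) *
        matchingSum w ((⊤ : G.Subgraph).deleteVerts {a, b}) +
      matchingSum w ((⊤ : G.Subgraph).deleteVerts {c, b}) *
        matchingSum w ((⊤ : G.Subgraph).deleteVerts {a, d}) := by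
  have main : ∀ X Y : Finset α, Disjoint X Y → X ∪ Y = {a, b, c, d} → _ := fun X Y hXY hT ↦
    matchingSum_mul_matchingSum w hXY hδ hδ0 hT hab.symm hbc hbd hcross
  have d1 : Disjoint ({c, d} : Finset α) {a, b} := by simp [*]
  have d2 : Disjoint ({c, b} : Finset α) {a, d} := by simp [*, ne_comm]
  have d3 : Disjoint ({a, b, c, d} : Finset α) ∅ := by simp
  have e1 := main {c, d} {a, b} d1 (by ext; simp; tauto)
  have e2 := main {a, b, c, d} ∅ d3 (by simp)
  have e3 := main {c, b} {a, d} d2 (by ext; simp; tauto)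
  have ha0 := hδ0 a
  -- Here `a` has the colour opposite to both `b` and `d`, so its partner must be missed by the same
  -- matching. One type is left for each product on the right, and both exchange into the product on
  -- the left.
  have z1 := pairSum_eq_zero w d1 hδ had (by simp [signedColour, hd, hac, had]; omega)
  have z3 := pairSum_eq_zero w d2 hδ hab (by simp [signedColour, hb, hab, hac]; omega)
  have s1 := pairSum_symmDiff (G := G) w (a := a) (S := {a, b}) d1 d3
    (by ext; grind [Finset.mem_symmDiff]) (by ext; grind [Finset.mem_symmDiff])
  have s2 := pairSum_symmDiff (G := G) w (a := a) (S := {a, d}) d2 d3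
    (by ext; grind [Finset.mem_symmDiff]) (by ext; grind [Finset.mem_symmDiff])
  push_cast at e1 e2 e3
  rw [SimpleGraph.Subgraph.deleteVerts_empty] at e2
  rw [e1, e2, e3, z1, z3, s1, s2]
  ring

end Kuo

theorem corollary3p7 {α : Type*} [Fintype α] {R : Type*} [CommRing R]
    (G : SimpleGraph α) (w : Sym2 α → R) (D : PlaneDrawing G)
    (U V : Finset α) (hG : G.IsBipartiteWith (U : Set α) (V : Set α))
    (hcover : ∀ x, x ∈ U ∨ x ∈ V) (hcard : U.card = V.card)
    (a₁ b₁ a₂ b₂ : α) (he : G.Adj a₂ b₂)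
    (F : Set ℂ) (hF : D.IsFace F) (hcyc : D.CyclicOnFace F a₁ b₁ a₂ b₂) :
    (((a₁ ∈ U ∧ b₂ ∈ U ∧ a₂ ∈ V ∧ b₁ ∈ V) ∨ (a₁ ∈ V ∧ b₂ ∈ V ∧ a₂ ∈ U ∧ b₁ ∈ U)) →
      matchingSum w (⊤ : G.Subgraph) *
          matchingSum w (((⊤ : G.Subgraph).deleteVerts {a₁, b₁}).deleteEdges {s(a₂, b₂)}) =
        matchingSum w ((⊤ : G.Subgraph).deleteVerts {a₁, b₁}) *
            matchingSum w ((⊤ : G.Subgraph).deleteEdges {s(a₂, b₂)}) +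
          w s(a₂, b₂) * matchingSum w ((⊤ : G.Subgraph).deleteVerts {a₁, a₂}) *
            matchingSum w ((⊤ : G.Subgraph).deleteVerts {b₁, b₂})) ∧
    (((a₁ ∈ U ∧ a₂ ∈ U ∧ b₁ ∈ V ∧ b₂ ∈ V) ∨ (a₁ ∈ V ∧ a₂ ∈ V ∧ b₁ ∈ U ∧ b₂ ∈ U)) →
      matchingSum w (⊤ : G.Subgraph) *
          matchingSum w (((⊤ : G.Subgraph).deleteVerts {a₁, b₁}).deleteEdges {s(a₂, b₂)}) =
        matchingSum w ((⊤ : G.Subgraph).deleteVerts {a₁, b₁}) *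
            matchingSum w ((⊤ : G.Subgraph).deleteEdges {s(a₂, b₂)}) -
          w s(a₂, b₂) * matchingSum w ((⊤ : G.Subgraph).deleteVerts {a₂, b₁}) *
            matchingSum w ((⊤ : G.Subgraph).deleteVerts {a₁, b₂})) := by
  obtain ⟨hab, hac, had, hbc, hbd, hcd⟩ := hcyc.pairwise_ne
  obtain ⟨δ, hδ, hδ0, hU, hV⟩ := exists_sign_of_isBipartiteWith hG
  have hcross := hcyc.exists_mem_support hF
  have e1 := matchingSum_eq_add w (H := (⊤ : G.Subgraph)) (a := a₂) (b := b₂) he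
  have e2 := matchingSum_eq_add w (H := (⊤ : G.Subgraph).deleteVerts {a₁, b₁}) (a := a₂) (b := b₂)
    (by simp [he, hac.symm, had.symm, hbc.symm, hbd.symm])
  rw [SimpleGraph.Subgraph.deleteVerts_deleteVerts, Set.insert_union, Set.singleton_union] at e2
  constructor
  · intro h
    have hcol : δ b₁ = -δ a₁ ∧ δ b₂ = δ a₁ := by
      rcases h with ⟨h1, h2, -, h4⟩ | ⟨h1, h2, -, h4⟩
      · rw [hU _ h1, hU _ h2, hV _ h4]; simp
      · rw [hV _ h1, hV _ h2, hU _ h4]; simp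
    have k := matchingSum_condensation_adjacent w hδ hδ0 hab hac had hbc hbd hcd hcross
      hcol.1 hcol.2
    rw [e2] at k ⊢
    rw [e1] at k ⊢
    -- After both expansions the difference of the two sides is `ω_e` times the condensation
    -- identity.
    linear_combination w s(a₂, b₂) * k
  · intro h
    have hcol : δ b₁ = -δ a₁ ∧ δ b₂ = -δ a₁ := by
      rcases h with ⟨h1, -, h3, h4⟩ | ⟨h1, -, h3, h4⟩
      · rw [hU _ h1, hV _ h3, hV _ h4]; simp
      · rw [hV _ h1, hU _ h3, hU _ h4]; simp
    have k := matchingSum_condensation_alternating w hδ hδ0 hab hac had hbc hbd hcd hcross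
      hcol.1 hcol.2
    rw [e2] at k ⊢
    rw [e1] at k ⊢
    linear_combination -w s(a₂, b₂) * k
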